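/- Theorem 2. Let $\lambda,\mu,c>0$, $\alpha>2$ and $\mathbf x\in\mathbb R^2$. Let $$p^{(ac)}(\mathbf x,t)=\frac{\lambda}{2\pi c}\,\frac{\exp\left(-\lambda t+\frac{\lambda}{c}\sqrt{c^2t^2-\|\mathbf x\|^2}\right)}{\sqrt{c^2t^2-\|\mathbf x\|^2}}\quad(\|\mathbf x\|<ct),\qquad p^{(ac)}(\mathbf x,t)=0\ \text{ otherwise},$$ be the density of the absolutely continuous component of the planar symmetric Markov random flight with speed $c$ and rate $\lambda$ of changes of direction, let $q(t)=\frac{\mu^\alpha}{\Gamma(\alpha)}t^{\alpha-1}e^{-\mu t}$ ($t>0$) be the density of the $(\mu,\alpha)$-gamma distributed lifetime, and let $p_l(\mathbf x)=\int_0^\infty p^{(ac)}(\mathbf x,\tau)\,q(\tau)\,d\tau$ be the stationary density. Then $$p_l(\mathbf x)=\frac{\lambda\mu^\alpha}{2\pi c\,\Gamma(\alpha)}\int_{\|\mathbf x\|/c}^\infty \tau^{\alpha-1}e^{-(\lambda+\mu)\tau}\,\frac{\exp\left(\frac{\lambda}{c}\sqrt{c^2\tau^2-\|\mathbf x\|^2}\right)}{\sqrt{c^2\tau^2-\|\mathbf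 x\|^2}}\,d\tau,$$ where the integral converges. If $\alpha$ is not an integer, then $$p_l(\mathbf x)=\frac{\lambda\mu^\alpha}{4\pi c^2\,\Gamma(\alpha)}\sum_{k=0}^\infty\frac{\lambda^k}{k!}\,T_k(\alpha),$$ where, with $z=(\lambda+\mu)^2\frac{\|\mathbf x\|^2}{4c^2}$, $$\begin{aligned}T_k(\alpha)&=\left(\tfrac{\|\mathbf x\|}{c}\right)^{\alpha+k-1}B\left(\tfrac{k+1}{2},-\tfrac{\alpha+k-1}{2}\right)\,{}_1F_2\left(\tfrac{\alpha}{2};\tfrac12,\tfrac{\alpha+k+1}{2};z\right)\\&\quad-(\lambda+\mu)\left(\tfrac{\|\mathbf x\|}{c}\right)^{\alpha+k}B\left(\tfrac{k+1}{2},-\tfrac{\alpha+k}{2}\right)\,{}_1F_2\left(\tfrac{1+\alpha}{2};\tfrac32,\tfrac{\alpha+k}{2}+1;z\right)\\&\quad+2(\lambda+\mu)^{1-\alpha-k}\,\Gamma(\alpha+k-1)\,{}_1F_2\left(-\tfrac{k-1}{2};-\tfrac{\alpha+k-3}{2},-\tfrac{\alpha+k-2}{2};z\right),\end{aligned}$$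 $B(u,v)=\Gamma(u)\Gamma(v)/\Gamma(u+v)$ is the beta function continued to negative arguments, and ${}_1F_2(\xi;\eta,\zeta;z)=\sum_{n\ge0}\frac{(\xi)_n}{(\eta)_n(\zeta)_n}\frac{z^n}{n!}$ with $(a)_n$ the rising factorial. For every $\alpha>2$, integer or not, the limit of $T_k(\beta)$ as $\beta\to\alpha$ through non-integer $\beta$ exists and is finite for each $k$, and the series formula holds with $T_k(\alpha)$ replaced by this limit. -/

import Mathlib

open MeasureTheory Filter Topology

noncomputable section

/-- The density, at the point `x` of the plane and at time `t`, of the absolutely continuous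
component of the distribution of the planar symmetric Markov random flight with speed `c` and
rate `lam` of changes of direction. The indicator `‖x‖ < c * t` is the Heaviside factor. -/
def flightACDensity (lam c : ℝ) (x : EuclideanSpace ℝ (Fin 2)) (t : ℝ) : ℝ :=
  if ‖x‖ < c * t then
    lam / (2 * Real.pi * c) *
      (Real.exp (-lam * t + lam / c * Real.sqrt (c ^ 2 * t ^ 2 - ‖x‖ ^ 2)) /
        Real.sqrt (c ^ 2 * t ^ 2 - ‖x‖ ^ 2))
  else 0

/-- The stationary density of the flight whose lifetime has density `q`: the absolutely continuous
component averaged over the lifetime. -/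
def stationaryDensity (lam c : ℝ) (q : ℝ → ℝ) (x : EuclideanSpace ℝ (Fin 2)) : ℝ :=
  ∫ t in Set.Ioi (0 : ℝ), flightACDensity lam c x t * q t

/-- The density of the gamma distributed lifetime with rate `μ` and shape `α`. -/
def gammaLifetimeDensity (μ α t : ℝ) : ℝ :=
  if 0 < t then μ ^ α / Real.Gamma α * t ^ (α - 1) * Real.exp (-μ * t) else 0

/-- The stationary density of the flight with `(μ, α)`-gamma distributed lifetime. -/
def lightDensity (lam c μ α : ℝ) (x : EuclideanSpace ℝ (Fin 2)) : ℝ :=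
  stationaryDensity lam c (gammaLifetimeDensity μ α) x

/-- The `n`-th term of the hypergeometric series `₁F₂(ξ; η, ζ; z)`; `ascPochhammer` is the rising
factorial. -/
def hyp1F2Term (ξ η ζ z : ℝ) (n : ℕ) : ℝ :=
  (ascPochhammer ℝ n).eval ξ / ((ascPochhammer ℝ n).eval η * (ascPochhammer ℝ n).eval ζ) *
    (z ^ n / (n.factorial : ℝ))

/-- The hypergeometric function `₁F₂(ξ; η, ζ; z)`. It is used only for parameters `η`, `ζ` that are
not integers `≤ 0`. -/
def hyp1F2 (ξ η ζ z : ℝ) : ℝ := ∑' n : ℕ, hyp1F2Term ξ η ζ z n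

/-- The series defining `₁F₂` converges, so that `hyp1F2` is its sum. -/
theorem summable_hyp1F2Term (ξ η ζ z : ℝ) : Summable (hyp1F2Term ξ η ζ z) := by
  have hrec : ∀ n, hyp1F2Term ξ η ζ z (n + 1) =
      hyp1F2Term ξ η ζ z n * ((ξ + n) / (η + n) * ((1 / (ζ + n)) * (z / (n + 1)))) := by
    intro n
    simp only [hyp1F2Term, ascPochhammer_succ_eval, pow_succ, Nat.factorial_succ]
    push_cast
    simp only [div_eq_mul_inv, mul_inv, one_mul]
    ring
  have hn : Tendsto (fun n : ℕ => (n : ℝ)) atTop atTop := tendsto_natCast_atTop_atTop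
  have h1 : Tendsto (fun n : ℕ => (ξ + n) / (η + n)) atTop (𝓝 1) := by
    have hd : Tendsto (fun n : ℕ => (ξ - η) / (η + n)) atTop (𝓝 0) :=
      tendsto_const_nhds.div_atTop (tendsto_atTop_add_const_left _ _ hn)
    have h := hd.const_add 1
    rw [add_zero] at h
    refine h.congr' ?_
    filter_upwards [(tendsto_atTop_add_const_left _ η hn).eventually_gt_atTop 0] with n hpos
    field_simp
    ring
  have h2 : Tendsto (fun n : ℕ => 1 / (ζ + n)) atTop (𝓝 0) :=
    tendsto_const_nhds.div_atTop (tendsto_atTop_add_const_left _ _ hn)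
  have h3 : Tendsto (fun n : ℕ => z / ((n : ℝ) + 1)) atTop (𝓝 0) :=
    tendsto_const_nhds.div_atTop (tendsto_atTop_add_const_right _ _ hn)
  have h4 := (h1.mul (h2.mul h3)).norm
  simp only [mul_zero, norm_zero] at h4
  refine summable_of_ratio_norm_eventually_le (r := 1 / 2) (by norm_num) ?_
  filter_upwards [h4.eventually_le_const (show (0 : ℝ) < 1 / 2 by norm_num)] with n hle
  rw [hrec, norm_mul, mul_comm]
  exact mul_le_mul_of_nonneg_right hle (norm_nonneg _)

/-- The combination of three `₁F₂` functions in the `k`-th term of the series, as a function of the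
shape parameter `α`. Here `ProbabilityTheory.beta u v = Γ(u) Γ(v) / Γ(u + v)`, which is the beta
function continued to negative arguments. -/
def lightBracket (lam c μ : ℝ) (x : EuclideanSpace ℝ (Fin 2)) (k : ℕ) (α : ℝ) : ℝ :=
  (‖x‖ / c) ^ (α + k - 1) * ProbabilityTheory.beta ((k + 1) / 2) (-(α + k - 1) / 2) *
      hyp1F2 (α / 2) (1 / 2) ((α + k + 1) / 2) ((lam + μ) ^ 2 * ‖x‖ ^ 2 / (4 * c ^ 2))
    - (lam + μ) * (‖x‖ / c) ^ (α + k) * ProbabilityTheory.beta ((k + 1) / 2) (-(α + k) / 2) *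
      hyp1F2 ((1 + α) / 2) (3 / 2) ((α + k) / 2 + 1) ((lam + μ) ^ 2 * ‖x‖ ^ 2 / (4 * c ^ 2))
    + 2 * (lam + μ) ^ (1 - α - k) * Real.Gamma (α + k - 1) *
      hyp1F2 (-((k : ℝ) - 1) / 2) (-(α + k - 3) / 2) (-(α + k - 2) / 2)
        ((lam + μ) ^ 2 * ‖x‖ ^ 2 / (4 * c ^ 2))

end

/-! Put a = ‖x‖/c and p = λ + μ. Expanding exp(λ√(τ² - a²)) in the integral for the density gives
terms that are all nonnegative, so summation and integration commute. The density becomes, up to a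
constant factor, the series of λ^k/k! times M_k(α) = ∫_a^∞ τ^(α-1) e^(-pτ) (τ² - a²)^((k-1)/2) dτ
(`lightMoment`). It remains to see that T_k(α) = 2 M_k(α) for non-integer α (`lightBracket_eq`).
Since M_k is continuous at every α > 3/2, it supplies the limits at integer shapes.

For a > 0 put s = (k-1)/2 and b = α + 2s, and expand (τ² - a²)^s in powers of (a/τ)². The j-th term
integrates to an upper incomplete gamma function at b - 2j, that is, a complete gamma value minus a
power series in p. The gamma values sum to the third ₁F₂. The rest is an absolutely convergent
double series; summed over j first, it gives beta values B(s+1, -(b+n)/2), and the even and the odd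
n give the other two ₁F₂. The beta sum and the incomplete gamma formula are classical for positive
arguments and reach negative non-integers through recursions under a unit shift
(`hasSum_binomCoeff_div`, `integral_Ioi_rpow_mul_exp_neg_mul`). -/

/-! ### Binomial coefficients: series, summability and decay -/

/-- The coefficient of `t ^ j` in the binomial series of `(1 - t) ^ s`. -/
noncomputable def binomCoeff (s : ℝ) (j : ℕ) : ℝ :=
  (ascPochhammer ℝ j).eval (-s) / (j.factorial : ℝ)

theorem binomCoeff_succ (s : ℝ) (j : ℕ) :
    binomCoeff s (j + 1) = binomCoeff s j * ((j - s) / (j + 1)) := by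
  have h : (j.factorial : ℝ) ≠ 0 := by positivity
  have h' : (j + 1 : ℝ) ≠ 0 := by positivity
  simp only [binomCoeff, ascPochhammer_succ_eval, Nat.factorial_succ]
  push_cast
  field_simp
  ring

theorem hasSum_binomCoeff_mul_pow (s : ℝ) {t : ℝ} (ht : |t| < 1) :
    HasSum (fun j => binomCoeff s j * t ^ j) ((1 - t) ^ s) := by
  have hb := Real.one_div_one_sub_rpow_hasFPowerSeriesOnBall_zero (-s)
  have hmem : t ∈ Metric.eball (0 : ℝ) 1 := by
    rw [Metric.mem_eball, edist_zero_right, ← ofReal_norm, Real.norm_eq_abs]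
    simpa using ht
  have h := hb.hasSum hmem
  have h1 : 0 < 1 - t := by linarith [(abs_lt.mp ht).2]
  simp only [zero_add, Real.rpow_neg h1.le, one_div, inv_inv] at h
  refine h.congr_fun fun j => ?_
  rw [FormalMultilinearSeries.ofScalars_apply_eq, smul_eq_mul]
  congr 1
  rw [Ring.choose, show -s + j - 1 - j + 1 = -s by ring]
  have := Ring.factorial_nsmul_multichoose_eq_ascPochhammer (-s) j
  rw [Polynomial.ascPochhammer_smeval_eq_eval, nsmul_eq_mul] at this
  rw [binomCoeff, ← this, mul_div_cancel_left₀ _ (by positivity)]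

theorem abs_binomCoeff_succ {s : ℝ} {j : ℕ} (hj : s ≤ j) :
    |binomCoeff s (j + 1)| = |binomCoeff s j| * ((j - s) / (j + 1)) := by
  rw [binomCoeff_succ, abs_mul, abs_of_nonneg (a := (j - s) / (j + 1))]
  exact div_nonneg (by linarith) (by positivity)

theorem abs_binomCoeff_sub_succ {s : ℝ} {j : ℕ} (hj : s ≤ j) :
    |binomCoeff s j| - |binomCoeff s (j + 1)| = (1 + s) * (|binomCoeff s j| / (j + 1)) := by
  rw [abs_binomCoeff_succ hj]
  have h' : (j + 1 : ℝ) ≠ 0 := by positivity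
  field_simp
  ring

/-- From the index ⌈s⌉ on, (1 + s)|c_j|/(j + 1) is the drop |c_j| - |c_(j+1)|, so the partial sums
telescope and stay bounded. -/
theorem summable_abs_binomCoeff_div {s : ℝ} (hs : -1 < s) :
    Summable fun j : ℕ => |binomCoeff s j| / (j + 1) := by
  set N := ⌈s⌉₊ with hN
  have hsN : s ≤ N := Nat.le_ceil s
  rw [← summable_nat_add_iff N]
  refine summable_of_sum_range_le (c := |binomCoeff s N| / (1 + s))
    (fun n => by positivity) (fun n => ?_)
  have h1 : 0 < 1 + s := by linarith
  rw [le_div_iff₀ h1, mul_comm, Finset.mul_sum]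
  have : ∀ i ∈ Finset.range n,
      (1 + s) * (|binomCoeff s (i + N)| / (((i + N : ℕ) : ℝ) + 1)) =
        |binomCoeff s (i + N)| - |binomCoeff s (i + 1 + N)| := by
    intro i _
    rw [← abs_binomCoeff_sub_succ (by push_cast; nlinarith [Nat.cast_nonneg (α := ℝ) i])]
    congr 3
    ring
  rw [Finset.sum_congr rfl this, Finset.sum_range_sub' (fun i => |binomCoeff s (i + N)|)]
  simp

/-- The absolute values eventually decrease; a positive limit would make the harmonic series
converge, by `summable_abs_binomCoeff_div`. -/
theorem tendsto_binomCoeff {s : ℝ} (hs : -1 < s) : Tendsto (binomCoeff s) atTop (𝓝 0) := by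
  set N := ⌈s⌉₊ with hN
  have hsN : s ≤ N := Nat.le_ceil s
  have hanti : Antitone fun i => |binomCoeff s (i + N)| := by
    refine antitone_nat_of_succ_le fun i => ?_
    have h := abs_binomCoeff_sub_succ (s := s) (j := i + N)
      (by push_cast; nlinarith [Nat.cast_nonneg (α := ℝ) i])
    have h2 : 0 ≤ (1 + s) * (|binomCoeff s (i + N)| / (((i + N : ℕ) : ℝ) + 1)) :=
      mul_nonneg (by linarith) (by positivity)
    rw [show i + 1 + N = i + N + 1 by ring]
    linarith
  have hbdd : BddBelow (Set.range fun i => |binomCoeff s (i + N)|) :=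
    ⟨0, by rintro _ ⟨i, rfl⟩; positivity⟩
  have hlim := tendsto_atTop_ciInf hanti hbdd
  set l := ⨅ i, |binomCoeff s (i + N)| with hl
  have hl0 : 0 ≤ l := le_ciInf fun i => abs_nonneg _
  rcases hl0.eq_or_lt with h0 | hpos
  · rw [← h0] at hlim
    exact (tendsto_zero_iff_abs_tendsto_zero _).mpr ((tendsto_add_atTop_iff_nat N).mp hlim)
  · exfalso
    have hsum := (summable_nat_add_iff N).mpr (summable_abs_binomCoeff_div hs)
    have : Summable fun j : ℕ => l * (1 / (((j + N : ℕ) : ℝ) + 1)) := by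
      refine hsum.of_nonneg_of_le (fun j => by positivity) (fun j => ?_)
      rw [mul_one_div]
      gcongr
      exact ciInf_le hbdd j
    rw [summable_mul_left_iff hpos.ne'] at this
    have h2 : Summable fun j : ℕ => 1 / ((j + (N + 1) : ℕ) : ℝ) := by
      refine this.congr fun j => ?_
      push_cast
      ring
    exact Real.not_summable_one_div_natCast ((summable_nat_add_iff (N + 1)).mp h2)

/-! ### Denominators bounded away from zero -/

theorem exists_pos_le_abs_add_int {v : ℝ} (hv : ∀ m : ℤ, v ≠ m) :
    ∃ δ > 0, ∀ m : ℤ, δ ≤ |v + m| := by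
  have h0 : 0 < Int.fract v := Int.fract_pos.mpr (hv _)
  have h1 := Int.fract_lt_one v
  refine ⟨min (Int.fract v) (1 - Int.fract v), lt_min h0 (by linarith), fun m => ?_⟩
  have e : v + m = ((⌊v⌋ + m : ℤ) : ℝ) + Int.fract v := by
    push_cast
    linarith [Int.floor_add_fract v]
  rw [e]
  rcases le_or_gt 0 (⌊v⌋ + m) with h | h
  · have : (0 : ℝ) ≤ ((⌊v⌋ + m : ℤ) : ℝ) := by exact_mod_cast h
    rw [abs_of_nonneg (by linarith)]
    exact (min_le_left _ _).trans (by linarith)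
  · have : ((⌊v⌋ + m : ℤ) : ℝ) ≤ -1 := by exact_mod_cast (show ⌊v⌋ + m ≤ -1 by omega)
    rw [abs_of_neg (by linarith)]
    exact (min_le_right _ _).trans (by linarith)

/-- If `b` is not an integer, `n - 2 j + b` is bounded below by a multiple of
`(j + 1) / (n + 1)`. -/
theorem exists_inv_abs_le {b : ℝ} (hb : ∀ m : ℤ, b ≠ m) :
    ∃ C > 0, ∀ n j : ℕ, |b + n - 2 * j|⁻¹ ≤ C * (n + 1) / (j + 1) := by
  obtain ⟨δ, hδ, h⟩ := exists_pos_le_abs_add_int hb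
  -- With D = |b + n - 2j| ≥ δ one has j + 1 ≤ (1 + |b|) + n + D, and D(1 + |b|)/δ is at least 1 +
  -- |b|, hence at least 1.
  refine ⟨(1 + |b|) / δ + 1, by positivity, fun n j => ?_⟩
  have hd : δ ≤ |b + n - 2 * j| := by
    have := h (n - 2 * j)
    push_cast at this
    rwa [← add_sub_assoc] at this
  have hdpos := hδ.trans_le hd
  rw [inv_le_comm₀ hdpos (by positivity), inv_div, div_le_iff₀ (by positivity)]
  have h1 : (2 * j : ℝ) ≤ |b| + n + |b + n - 2 * j| := by
    have := neg_abs_le (b + n - 2 * j)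
    have := le_abs_self b
    linarith
  have h2 : 1 + |b| ≤ |b + n - 2 * j| * ((1 + |b|) / δ) := by
    rw [mul_div_assoc', le_div_iff₀ hδ, mul_comm]
    gcongr
  have hn : (0 : ℝ) ≤ n := by positivity
  have hj : (0 : ℝ) ≤ j := by positivity
  nlinarith [abs_nonneg b]

theorem exists_inv_abs_add_le {v : ℝ} (hv : ∀ m : ℤ, v ≠ m) :
    ∃ C > 0, ∀ j : ℕ, |j + v|⁻¹ ≤ C / (j + 1) := by
  obtain ⟨δ, hδ, h⟩ := exists_pos_le_abs_add_int hv
  refine ⟨(1 + |v|) / δ + 1, by positivity, fun j => ?_⟩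
  have hd : δ ≤ |j + v| := by
    have := h j
    rw [add_comm]
    exact_mod_cast this
  have hdpos := hδ.trans_le hd
  rw [inv_le_comm₀ hdpos (by positivity), inv_div, div_le_iff₀ (by positivity)]
  have h1 : (j : ℝ) ≤ |v| + |j + v| := by
    have := le_abs_self (j + v)
    have := neg_abs_le v
    linarith
  have h2 : 1 + |v| ≤ |j + v| * ((1 + |v|) / δ) := by
    rw [mul_div_assoc', le_div_iff₀ hδ, mul_comm]
    gcongr
  linarith

/-! ### The beta function as a binomial sum -/

theorem summable_binomCoeff_div {s v : ℝ} (hs : -1 < s) (hv : ∀ m : ℤ, v ≠ m) :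
    Summable fun j : ℕ => binomCoeff s j / (j + v) := by
  obtain ⟨C, -, h⟩ := exists_inv_abs_add_le hv
  refine ((summable_abs_binomCoeff_div hs).mul_left C).of_norm_bounded fun j => ?_
  rw [Real.norm_eq_abs, abs_div, div_eq_mul_inv]
  calc _ ≤ |binomCoeff s j| * (C / (j + 1)) := by gcongr; exact h j
    _ = _ := by ring

/-- The partial sums of the difference telescope to c_n · n/(n + v), which tends to 0. The recursion
is that of the beta function in its second argument. -/
theorem tsum_binomCoeff_div_succ {s v : ℝ} (hs : -1 < s) (hv : ∀ m : ℤ, v ≠ m) :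
    (v + s + 1) * ∑' j : ℕ, binomCoeff s j / (j + (v + 1)) =
      v * ∑' j : ℕ, binomCoeff s j / (j + v) := by
  have hv1 : ∀ m : ℤ, v + 1 ≠ m := fun m h => hv (m - 1) (by push_cast; linarith)
  have hne : ∀ j : ℕ, (j : ℝ) + v ≠ 0 := fun j h => hv (-j) (by push_cast; linarith)
  have hs0 := (summable_binomCoeff_div hs hv).hasSum.mul_left v
  have hs1 := (summable_binomCoeff_div hs hv1).hasSum.mul_left (v + s + 1)
  have hsub := (hs0.sub hs1).tendsto_sum_nat
  have htele : ∀ n, ∑ j ∈ Finset.range n, (v * (binomCoeff s j / (j + v)) -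
      (v + s + 1) * (binomCoeff s j / (j + (v + 1)))) =
        binomCoeff s n * (n / (n + v)) := by
    intro n
    induction n with
    | zero => simp
    | succ n ih =>
      rw [Finset.sum_range_succ, ih, binomCoeff_succ]
      have h0 := hne n
      have h1 : (n : ℝ) + (v + 1) ≠ 0 := by
        have := hne (n + 1)
        push_cast at this
        rwa [add_assoc, add_comm 1 v] at this
      have h1' : (n : ℝ) + 1 + v ≠ 0 := by rwa [add_assoc, add_comm 1 v]
      have h2 : (n : ℝ) + 1 ≠ 0 := by positivity
      push_cast
      rw [show (n : ℝ) + 1 + v = n + (v + 1) by ring]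
      field_simp
      ring
  have hfrac : Tendsto (fun n : ℕ => (n : ℝ) / (n + v)) atTop (𝓝 1) :=
    tendsto_natCast_div_add_atTop v
  have hlim := (tendsto_binomCoeff hs).mul hfrac
  rw [zero_mul] at hlim
  have := tendsto_nhds_unique (hsub.congr htele) hlim
  linarith

/-- Integrate the binomial series of (1 - t)^s against t^(v-1) over (0, 1); the norms of the terms
integrate to a summable sequence. -/
theorem hasSum_binomCoeff_div_of_pos {s v : ℝ} (hs : -1 < s) (hv : 0 < v)
    (hv' : ∀ m : ℤ, v ≠ m) :
    HasSum (fun j : ℕ => binomCoeff s j / (j + v)) (ProbabilityTheory.beta (s + 1) v) := by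
  have hint : ∀ j : ℕ, ∫ t in (0 : ℝ)..1, t ^ (v - 1 + j) = 1 / (j + v) := by
    intro j
    have hj : (0 : ℝ) ≤ j := by positivity
    rw [integral_rpow (Or.inl (by linarith)), Real.one_rpow, Real.zero_rpow (by linarith)]
    ring
  have hI : ∀ j : ℕ, IntegrableOn (fun t : ℝ => t ^ (v - 1 + j)) (Set.Ioc 0 1) := fun j =>
    (intervalIntegrable_iff_integrableOn_Ioc_of_le zero_le_one).mp
      (intervalIntegral.intervalIntegrable_rpow' (by have : (0 : ℝ) ≤ j := by positivity
                                                     linarith))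
  simp only [intervalIntegral.integral_of_le zero_le_one, integral_Ioc_eq_integral_Ioo] at hint
  have hI' := fun j => (hI j).mono_set Set.Ioo_subset_Ioc_self
  have key := hasSum_integral_of_summable_integral_norm
    (F := fun j t => binomCoeff s j * t ^ (v - 1 + j)) (μ := volume.restrict (Set.Ioo 0 1))
    (fun j => (hI' j).const_mul _) ?_
  · have e : ∫ t in Set.Ioo (0 : ℝ) 1, ∑' j : ℕ, binomCoeff s j * t ^ (v - 1 + j) =
        ProbabilityTheory.beta (s + 1) v := by
      have hb : ProbabilityTheory.beta v (s + 1) = ProbabilityTheory.beta (s + 1) v := by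
        simp only [ProbabilityTheory.beta, add_comm v, mul_comm (Real.Gamma v)]
      rw [← hb, ProbabilityTheory.beta_eq_betaIntegralReal v (s + 1) hv (by linarith),
        Complex.betaIntegral, intervalIntegral.integral_of_le zero_le_one,
        integral_Ioc_eq_integral_Ioo]
      have : ∀ t ∈ Set.Ioo (0 : ℝ) 1, ((t : ℂ) ^ ((v : ℂ) - 1) *
          (1 - (t : ℂ)) ^ (((s + 1 : ℝ) : ℂ) - 1)) =
          ((∑' j : ℕ, binomCoeff s j * t ^ (v - 1 + j) : ℝ) : ℂ) := by
        intro t ht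
        have h1 : |t| < 1 := by rw [abs_of_pos ht.1]; exact ht.2
        have h2 := (hasSum_binomCoeff_mul_pow s h1).mul_left (t ^ (v - 1))
        have h3 : ∀ j : ℕ, binomCoeff s j * t ^ (v - 1 + j) =
            t ^ (v - 1) * (binomCoeff s j * t ^ j) := by
          intro j
          rw [Real.rpow_add ht.1, Real.rpow_natCast]
          ring
        simp only [h3]
        rw [h2.tsum_eq, Complex.ofReal_mul, Complex.ofReal_cpow ht.1.le,
          Complex.ofReal_cpow (by linarith [ht.2])]
        push_cast
        simp
      rw [setIntegral_congr_fun measurableSet_Ioo this, integral_complex_ofReal,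
        Complex.ofReal_re]
    rw [e] at key
    refine key.congr_fun fun j => ?_
    rw [integral_const_mul, hint, mul_one_div]
  · have : ∀ j : ℕ, ∫ t in Set.Ioo (0 : ℝ) 1, ‖binomCoeff s j * t ^ (v - 1 + j)‖ =
        ‖binomCoeff s j / (j + v)‖ := by
      intro j
      rw [setIntegral_congr_fun (g := fun t => |binomCoeff s j| * t ^ (v - 1 + j))
        measurableSet_Ioo, integral_const_mul, hint, norm_div, Real.norm_eq_abs,

        Real.norm_eq_abs, abs_of_nonneg (a := (j : ℝ) + v) (by positivity), mul_one_div]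
      intro t ht
      simp only [norm_mul, Real.norm_eq_abs]
      rw [abs_of_nonneg (Real.rpow_nonneg ht.1.le _)]
    simp only [this]
    exact (summable_binomCoeff_div hs hv').norm

theorem beta_add_one {u v : ℝ} (hv : v ≠ 0) (huv : u + v ≠ 0) :
    (u + v) * ProbabilityTheory.beta u (v + 1) = v * ProbabilityTheory.beta u v := by
  simp only [ProbabilityTheory.beta]
  rw [Real.Gamma_add_one hv, ← add_assoc, Real.Gamma_add_one huv, ← mul_div_mul_left _ _ huv]
  field_simp

theorem hasSum_binomCoeff_div {s v : ℝ} (hs : -1 < s) (hv : ∀ m : ℤ, v ≠ m) :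
    HasSum (fun j : ℕ => binomCoeff s j / (j + v)) (ProbabilityTheory.beta (s + 1) v) := by
  suffices h : ∀ (N : ℕ) (v : ℝ), (∀ m : ℤ, v ≠ m) → 0 < v + N →
      ∑' j : ℕ, binomCoeff s j / (j + v) = ProbabilityTheory.beta (s + 1) v by
    obtain ⟨N, hN⟩ := exists_nat_gt (-v)
    rw [← h N v hv (by linarith)]
    exact (summable_binomCoeff_div hs hv).hasSum
  intro N
  induction N with
  | zero =>
    intro v hv h0
    exact (hasSum_binomCoeff_div_of_pos hs (by simpa using h0) hv).tsum_eq
  | succ N ih =>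
    intro v hv h0
    have hv0 : v ≠ 0 := by simpa using hv 0
    have hrec := tsum_binomCoeff_div_succ hs hv
    rw [ih (v + 1) (fun m h => hv (m - 1) (by push_cast; linarith))
      (by push_cast at h0; linarith)] at hrec
    apply mul_left_cancel₀ hv0
    rw [← hrec]
    -- Here `beta_add_one` is unavailable, but both sides vanish: on the right the denominator is
    -- `Real.Gamma 0 = 0`, and division by zero returns 0, the true value of 1/Γ at the pole.
    by_cases h : s + 1 + v = 0
    · have : v + s + 1 = 0 := by linarith
      rw [this, zero_mul, ProbabilityTheory.beta, h, Real.Gamma_zero]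
      simp
    · rw [← beta_add_one hv0 h]
      ring

/-! ### Incomplete gamma functions -/

theorem integrableOn_rpow_mul_exp_neg_mul_Ioi (b : ℝ) {p a : ℝ} (hp : 0 < p) (ha : 0 < a) :
    IntegrableOn (fun τ : ℝ => τ ^ b * Real.exp (-p * τ)) (Set.Ioi a) := by
  refine integrable_of_isBigO_exp_neg (b := p / 2) (by positivity) ?_ ?_
  · intro τ hτ
    have : τ ≠ 0 := (ha.trans_le hτ).ne'
    exact ((Real.continuousAt_rpow_const _ _ (Or.inl this)).mul
      (by fun_prop)).continuousWithinAt
  · have h := (isLittleO_rpow_exp_pos_mul_atTop b (half_pos hp)).isBigO.mul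
      (Asymptotics.isBigO_refl (fun τ : ℝ => Real.exp (-p * τ)) atTop)
    refine h.congr_right fun τ => ?_
    rw [← Real.exp_add]
    congr 1
    ring

/-- The terms of the series for the lower incomplete gamma function. -/
noncomputable def lowerGammaTerm (p a b : ℝ) (n : ℕ) : ℝ :=
  (-p) ^ n / (n.factorial : ℝ) * (a ^ (b + n) / (b + n))

theorem summable_pow_mul_add_one_div_factorial (y : ℝ) :
    Summable fun n : ℕ => y ^ n / (n.factorial : ℝ) * (n + 1) := by
  have h0 := Real.summable_pow_div_factorial y
  have h1 : Summable fun n : ℕ => y ^ n / (n.factorial : ℝ) * n := by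
    rw [← summable_nat_add_iff 1]
    refine (h0.mul_left y).congr fun n => ?_
    rw [Nat.factorial_succ]
    push_cast
    have : (n.factorial : ℝ) ≠ 0 := by positivity
    have : (n + 1 : ℝ) ≠ 0 := by positivity
    field_simp
    rw [pow_succ, mul_comm]
  exact (h1.add h0).congr fun n => by ring

theorem summable_lowerGammaTerm {p a b : ℝ} (hp : 0 < p) (ha : 0 < a) (hb : ∀ m : ℤ, b ≠ m) :
    Summable (lowerGammaTerm p a b) := by
  obtain ⟨C, -, h⟩ := exists_inv_abs_add_le hb
  refine ((Real.summable_pow_div_factorial (p * a)).mul_left (a ^ b * C)).of_norm_bounded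
    fun n => ?_
  have h1 : |n + b|⁻¹ ≤ C := by
    refine (h n).trans (div_le_self ?_ (by have : (0 : ℝ) ≤ n := by positivity
                                           linarith))
    have := (by positivity : (0 : ℝ) ≤ |((0 : ℕ) : ℝ) + b|⁻¹).trans (h 0)
    simpa using this
  rw [lowerGammaTerm, Real.norm_eq_abs, abs_mul, abs_div, abs_div, abs_pow, abs_neg,
    abs_of_pos hp, Nat.abs_cast, abs_of_pos (Real.rpow_pos_of_pos ha _), Real.rpow_add ha,
    Real.rpow_natCast, add_comm b, div_eq_mul_inv (a ^ b * a ^ n)]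
  calc p ^ n / (n.factorial : ℝ) * (a ^ b * a ^ n * |n + b|⁻¹)
      ≤ p ^ n / (n.factorial : ℝ) * (a ^ b * a ^ n * C) := by gcongr
    _ = _ := by rw [mul_pow]; ring

theorem integral_Ioc_rpow_mul_exp_neg_mul {p a b : ℝ} (hp : 0 < p) (ha : 0 < a) (hb : 0 < b)
    (hb' : ∀ m : ℤ, b ≠ m) :
    ∫ τ in Set.Ioc 0 a, τ ^ (b - 1) * Real.exp (-p * τ) = ∑' n, lowerGammaTerm p a b n := by
  have hint : ∀ n : ℕ, ∫ t in (0 : ℝ)..a, t ^ (b - 1 + n) = a ^ (b + n) / (b + n) := by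
    intro n
    have hn : (0 : ℝ) ≤ n := by positivity
    rw [integral_rpow (Or.inl (by linarith)), Real.zero_rpow (by linarith), sub_zero]
    rw [show b - 1 + n + 1 = b + n by ring]
  have hI : ∀ n : ℕ, IntegrableOn (fun t : ℝ => t ^ (b - 1 + n)) (Set.Ioc 0 a) := fun n =>
    (intervalIntegrable_iff_integrableOn_Ioc_of_le ha.le).mp
      (intervalIntegral.intervalIntegrable_rpow' (by have hn : (0 : ℝ) ≤ n := by positivity
                                                     linarith))
  simp only [intervalIntegral.integral_of_le ha.le] at hint
  have key := hasSum_integral_of_summable_integral_norm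
    (F := fun (n : ℕ) t => (-p) ^ n / (n.factorial : ℝ) * t ^ (b - 1 + n))
    (μ := volume.restrict (Set.Ioc 0 a)) (fun n => (hI n).const_mul _) ?_
  · simp only [integral_const_mul, hint] at key
    rw [show (∑' n, lowerGammaTerm p a b n) = _ from key.tsum_eq]
    refine setIntegral_congr_fun measurableSet_Ioc fun t ht => ?_
    have h := (NormedSpace.expSeries_div_hasSum_exp (𝔸 := ℝ) (-p * t)).mul_left (t ^ (b - 1))
    rw [← Real.exp_eq_exp_ℝ] at h
    rw [← h.tsum_eq]
    refine tsum_congr fun n => ?_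
    rw [Real.rpow_add ht.1, Real.rpow_natCast, mul_pow]
    ring
  · refine (summable_lowerGammaTerm hp ha hb').norm.congr fun n => ?_
    rw [setIntegral_congr_fun (g := fun t => |(-p) ^ n / (n.factorial : ℝ)| * t ^ (b - 1 + n))
      measurableSet_Ioc, integral_const_mul, hint, lowerGammaTerm, Real.norm_eq_abs, abs_mul]
    · congr 1
      exact abs_of_nonneg (by positivity)
    · intro t ht
      simp only [norm_mul, Real.norm_eq_abs]
      rw [abs_of_nonneg (Real.rpow_nonneg ht.1.le _)]

/-- Termwise, b/(b + n) = 1 - n/(b + n): the 1 produces the exponential series, and the remainder,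
shifted by one index, the series at b + 1. -/
theorem tsum_lowerGammaTerm_succ {p a b : ℝ} (hp : 0 < p) (ha : 0 < a) (hb : ∀ m : ℤ, b ≠ m) :
    b * ∑' n, lowerGammaTerm p a b n =
      a ^ b * Real.exp (-p * a) + p * ∑' n, lowerGammaTerm p a (b + 1) n := by
  have hb1 : ∀ m : ℤ, b + 1 ≠ m := fun m h => hb (m - 1) (by push_cast; linarith)
  have hne : ∀ j : ℕ, b + (j : ℝ) ≠ 0 := fun j h => hb (-j) (by push_cast; linarith)
  have hs := (summable_lowerGammaTerm hp ha hb).mul_left b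
  have he := (NormedSpace.expSeries_div_hasSum_exp (𝔸 := ℝ) (-p * a)).mul_left (a ^ b)
  rw [← Real.exp_eq_exp_ℝ] at he
  rw [← tsum_mul_left, ← he.tsum_eq, ← tsum_mul_left, hs.tsum_eq_zero_add,
    he.summable.tsum_eq_zero_add, add_assoc,
    ← ((summable_nat_add_iff 1).mpr he.summable).tsum_add
      ((summable_lowerGammaTerm hp ha hb1).mul_left p)]
  congr 1
  · have h0 : b ≠ 0 := by simpa using hb 0
    simp [lowerGammaTerm]
    field_simp
  · refine tsum_congr fun n => ?_
    have h1 := hne (n + 1)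
    push_cast at h1
    have hf : (n.factorial : ℝ) ≠ 0 := by positivity
    have hn : (n + 1 : ℝ) ≠ 0 := by positivity
    simp only [lowerGammaTerm, Nat.factorial_succ]
    push_cast
    rw [show b + 1 + (n : ℝ) = b + (n + 1) by ring, Real.rpow_add ha b,
      show (a ^ ((n : ℝ) + 1)) = a ^ (n + 1) by exact_mod_cast Real.rpow_natCast a (n + 1),
      mul_pow, pow_succ (-p)]
    field_simp
    ring

/-- Integration by parts; b may be any real because the interval stays away from 0. -/
theorem integral_Ioi_rpow_mul_exp_neg_mul_succ {p a b : ℝ} (hp : 0 < p) (ha : 0 < a) :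
    b * ∫ τ in Set.Ioi a, τ ^ (b - 1) * Real.exp (-p * τ) =
      p * (∫ τ in Set.Ioi a, τ ^ (b + 1 - 1) * Real.exp (-p * τ)) - a ^ b * Real.exp (-p * a) := by
  have hd : ∀ τ ∈ Set.Ici a, HasDerivAt (fun τ : ℝ => τ ^ b * Real.exp (-p * τ))
      (b * (τ ^ (b - 1) * Real.exp (-p * τ)) - p * (τ ^ b * Real.exp (-p * τ))) τ := by
    intro τ hτ
    have h0 : τ ≠ 0 := (ha.trans_le hτ).ne'
    have h1 : HasDerivAt (fun τ : ℝ => Real.exp (-p * τ)) (Real.exp (-p * τ) * (-p)) τ := by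
      simpa using ((hasDerivAt_id τ).const_mul (-p)).exp
    refine ((Real.hasDerivAt_rpow_const (p := b) (Or.inl h0)).mul h1).congr_deriv ?_
    ring
  have i1 := (integrableOn_rpow_mul_exp_neg_mul_Ioi (b - 1) hp ha).const_mul b
  have i2 := (integrableOn_rpow_mul_exp_neg_mul_Ioi b hp ha).const_mul p
  have h := integral_Ioi_of_hasDerivAt_of_tendsto' hd (i1.sub i2)
    (by simpa only [neg_mul] using tendsto_rpow_mul_exp_neg_mul_atTop_nhds_zero b p hp)
  rw [integral_sub i1 i2, integral_const_mul, integral_const_mul] at h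
  rw [add_sub_cancel_right]
  linarith

/-- The upper incomplete gamma function at a non-integer argument. -/
theorem integral_Ioi_rpow_mul_exp_neg_mul {p a b : ℝ} (hp : 0 < p) (ha : 0 < a)
    (hb : ∀ m : ℤ, b ≠ m) :
    ∫ τ in Set.Ioi a, τ ^ (b - 1) * Real.exp (-p * τ) =
      p ^ (-b) * Real.Gamma b - ∑' n, lowerGammaTerm p a b n := by
  -- Both sides obey the same recursion from b to b + 1, so the claim descends from b > 0, where it
  -- is the gamma integral split at a.
  suffices h : ∀ (N : ℕ) (b : ℝ), (∀ m : ℤ, b ≠ m) → 0 < b + N →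
      ∫ τ in Set.Ioi a, τ ^ (b - 1) * Real.exp (-p * τ) =
        p ^ (-b) * Real.Gamma b - ∑' n, lowerGammaTerm p a b n by
    obtain ⟨N, hN⟩ := exists_nat_gt (-b)
    exact h N b hb (by linarith)
  intro N
  induction N with
  | zero =>
    intro b hb h0
    have hb0 : 0 < b := by simpa using h0
    have hfull : IntegrableOn (fun τ : ℝ => τ ^ (b - 1) * Real.exp (-p * τ)) (Set.Ioi 0) := by
      simpa using integrableOn_rpow_mul_exp_neg_mul_rpow (s := b - 1) (p := 1) (by linarith)
        one_pos hp
    have hG := Real.integral_rpow_mul_exp_neg_mul_Ioi hb0 hp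
    simp only [← neg_mul] at hG
    rw [← Set.Ioc_union_Ioi_eq_Ioi ha.le, setIntegral_union (Set.Ioc_disjoint_Ioi le_rfl)
      measurableSet_Ioi (hfull.mono_set Set.Ioc_subset_Ioi_self)
      (hfull.mono_set (Set.Ioi_subset_Ioi ha.le)),
      integral_Ioc_rpow_mul_exp_neg_mul hp ha hb0 hb] at hG
    rw [Real.rpow_neg hp.le, ← Real.inv_rpow hp.le, ← one_div]
    linarith
  | succ N ih =>
    intro b hb h0
    have hb0 : b ≠ 0 := by simpa using hb 0
    apply mul_left_cancel₀ hb0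
    rw [integral_Ioi_rpow_mul_exp_neg_mul_succ hp ha,
      ih (b + 1) (fun m h => hb (m - 1) (by push_cast; linarith)) (by push_cast at h0; linarith),
      mul_sub, mul_sub, tsum_lowerGammaTerm_succ hp ha hb, Real.Gamma_add_one hb0,
      show -b = -(b + 1) + 1 by ring, Real.rpow_add_one hp.ne']
    ring

/-! ### Factorials, gamma and beta values as rising factorials -/

theorem factorial_two_mul (m : ℕ) :
    ((2 * m).factorial : ℝ) = 4 ^ m * (m.factorial : ℝ) * (ascPochhammer ℝ m).eval (1 / 2) := by
  induction m with
  | zero => simp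
  | succ m ih =>
    rw [show 2 * (m + 1) = 2 * m + 1 + 1 by ring, Nat.factorial_succ, Nat.factorial_succ,
      ascPochhammer_succ_eval, Nat.factorial_succ]
    push_cast
    rw [ih]
    ring

theorem factorial_two_mul_add_one (m : ℕ) :
    ((2 * m + 1).factorial : ℝ) =
      4 ^ m * (m.factorial : ℝ) * (ascPochhammer ℝ m).eval (3 / 2) := by
  induction m with
  | zero => simp
  | succ m ih =>
    rw [show 2 * (m + 1) + 1 = 2 * m + 1 + 1 + 1 by ring, Nat.factorial_succ (2 * m + 1 + 1),
      Nat.factorial_succ (2 * m + 1), ascPochhammer_succ_eval, Nat.factorial_succ m]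
    push_cast
    rw [ih]
    ring

/-- Each shift by 2 uses the functional equation twice; halving the two factors yields one step of
each rising factorial and a factor 4. -/
theorem Gamma_sub_two_mul {b : ℝ} (hb : ∀ m : ℤ, b ≠ m) (j : ℕ) :
    Real.Gamma (b - 2 * j) = Real.Gamma b / (4 ^ j *
      ((ascPochhammer ℝ j).eval (-(b - 2) / 2) * (ascPochhammer ℝ j).eval (-(b - 1) / 2))) := by
  induction j with
  | zero => simp
  | succ j ih =>
    have h1 : b - 2 * j - 1 ≠ 0 := fun h => hb (2 * j + 1) (by push_cast; linarith)
    have h2 : b - 2 * j - 2 ≠ 0 := fun h => hb (2 * j + 2) (by push_cast; linarith)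
    have e : Real.Gamma (b - 2 * j) =
        (b - 2 * j - 1) * ((b - 2 * j - 2) * Real.Gamma (b - 2 * (j + 1 : ℕ))) := by
      rw [show b - 2 * j = b - 2 * j - 1 + 1 by ring, Real.Gamma_add_one h1,
        show b - 2 * j - 1 = b - 2 * j - 2 + 1 by ring, Real.Gamma_add_one h2]
      push_cast
      ring_nf
    have e' : (4 : ℝ) * ((-(b - 2) / 2 + j) * (-(b - 1) / 2 + j)) =
        (b - 2 * j - 1) * (b - 2 * j - 2) := by ring
    rw [ascPochhammer_succ_eval, ascPochhammer_succ_eval, pow_succ]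
    rw [show ∀ P Q x y : ℝ, (4 : ℝ) ^ j * 4 * (P * x * (Q * y)) =
      4 ^ j * (P * Q) * (4 * (x * y)) by intros; ring, e', ← div_div, ← ih, e]
    field_simp

theorem beta_sub_natCast {u v : ℝ} (hv : ∀ m : ℤ, v ≠ m) (huv : ∀ m : ℤ, u + v ≠ m) (m : ℕ) :
    ProbabilityTheory.beta u (v - m) = ProbabilityTheory.beta u v *
      ((ascPochhammer ℝ m).eval (1 - u - v) / (ascPochhammer ℝ m).eval (1 - v)) := by
  induction m with
  | zero => simp
  | succ m ih =>
    have h1 : v - (m + 1 : ℕ) ≠ 0 := fun h => hv (m + 1) (by push_cast at h ⊢; linarith)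
    have h2 : u + (v - (m + 1 : ℕ)) ≠ 0 := fun h => huv (m + 1) (by push_cast at h ⊢; linarith)
    have h := beta_add_one h1 h2
    rw [show v - (m + 1 : ℕ) + 1 = v - m by push_cast; ring, ih] at h
    have h3 : 1 - v + m ≠ 0 := fun h => hv (m + 1) (by push_cast at h ⊢; linarith)
    rw [ascPochhammer_succ_eval, ascPochhammer_succ_eval, mul_div_mul_comm,
      show (1 - u - v + m) / (1 - v + m) = (u + (v - (m + 1 : ℕ))) / (v - (m + 1 : ℕ)) by
        rw [← neg_div_neg_eq]; congr 1 <;> push_cast <;> ring,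
      ← mul_assoc, mul_div_assoc', eq_div_iff h1, mul_comm _ (v - _), ← h]
    ring

/-! ### Closed form of the moment integral -/

/-- Once 2j > b, integration by parts bounds the integral by a^(b-2j)/(2j - b), so the terms are
O(|c_j|/(j + 1)). -/
theorem summable_binomCoeff_mul_integral {p a s b : ℝ} (hp : 0 < p) (ha : 0 < a) (hs : -1 < s)
    (hb : ∀ m : ℤ, b ≠ m) :
    Summable fun j : ℕ => |binomCoeff s j| * (a ^ (2 * j) *
      ∫ τ in Set.Ioi a, τ ^ (b - 2 * j - 1) * Real.exp (-p * τ)) := by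
  obtain ⟨C, hC, h⟩ := exists_inv_abs_le hb
  have hnn : ∀ b : ℝ, 0 ≤ ∫ τ in Set.Ioi a, τ ^ (b - 1) * Real.exp (-p * τ) := fun b =>
    setIntegral_nonneg measurableSet_Ioi fun τ hτ =>
      mul_nonneg (Real.rpow_nonneg (ha.trans hτ).le _) (Real.exp_nonneg _)
  refine ((summable_abs_binomCoeff_div hs).mul_left (C * a ^ b)).of_norm_bounded_eventually_nat ?_
  obtain ⟨N, hN⟩ := exists_nat_gt b
  filter_upwards [eventually_ge_atTop N] with j hj
  have hjb : b < 2 * j := by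
    have : (N : ℝ) ≤ j := by exact_mod_cast hj
    have : (0 : ℝ) ≤ j := by positivity
    linarith
  rw [Real.norm_of_nonneg (mul_nonneg (abs_nonneg _) (mul_nonneg (by positivity) (hnn _)))]
  have h0 := h 0 j
  rw [Nat.cast_zero, add_zero, abs_of_neg (by linarith)] at h0
  have hrec := integral_Ioi_rpow_mul_exp_neg_mul_succ (b := b - 2 * j) hp ha
  set G := ∫ τ in Set.Ioi a, τ ^ (b - 2 * j - 1) * Real.exp (-p * τ)
  have hle : (2 * j - b) * G ≤ a ^ (b - 2 * j) := by
    have := mul_nonneg hp.le (hnn (b - 2 * j + 1))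
    have : a ^ (b - 2 * j) * Real.exp (-p * a) ≤ a ^ (b - 2 * j) :=
      mul_le_of_le_one_right (by positivity) (Real.exp_le_one_iff.mpr (by nlinarith))
    linarith
  have hG : G ≤ a ^ (b - 2 * j) * (C / (j + 1)) := by
    rw [mul_comm, ← le_div_iff₀ (by linarith), div_eq_mul_inv] at hle
    refine hle.trans (mul_le_mul_of_nonneg_left ?_ (by positivity))
    calc (2 * j - b)⁻¹ = (-(b - 2 * j))⁻¹ := by ring_nf
      _ ≤ _ := by simpa using h0
  have hpow : a ^ (2 * j) * a ^ (b - 2 * j) = a ^ b := by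
    rw [← Real.rpow_natCast, ← Real.rpow_add ha]
    push_cast
    ring_nf
  calc |binomCoeff s j| * (a ^ (2 * j) * G)
      ≤ |binomCoeff s j| * (a ^ (2 * j) * (a ^ (b - 2 * j) * (C / (j + 1)))) := by gcongr
    _ = |binomCoeff s j| * ((a ^ (2 * j) * a ^ (b - 2 * j)) * (C / (j + 1))) := by ring
    _ = _ := by rw [hpow]; ring

theorem hasSum_rpow_mul_sq_sub_sq_rpow {a α s τ : ℝ} (ha : 0 < a) (hτ : a < τ) :
    HasSum (fun j : ℕ => binomCoeff s j * (a ^ (2 * j) * τ ^ (α + 2 * s - 2 * j - 1)))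
      (τ ^ (α - 1) * (τ ^ 2 - a ^ 2) ^ s) := by
  have hτ0 := ha.trans hτ
  have ht : |(a / τ) ^ 2| < 1 := by
    rw [abs_of_nonneg (by positivity)]
    exact pow_lt_one₀ (by positivity) ((div_lt_one hτ0).mpr hτ) two_ne_zero
  have h := (hasSum_binomCoeff_mul_pow s ht).mul_left (τ ^ (α + 2 * s - 1))
  have e : τ ^ (α - 1) * (τ ^ 2 - a ^ 2) ^ s = τ ^ (α + 2 * s - 1) * (1 - (a / τ) ^ 2) ^ s := by
    have h1 : 0 ≤ 1 - (a / τ) ^ 2 := by linarith [le_abs_self ((a / τ) ^ 2)]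
    rw [show τ ^ 2 - a ^ 2 = τ ^ 2 * (1 - (a / τ) ^ 2) by field_simp,
      Real.mul_rpow (by positivity) h1, ← Real.rpow_natCast, ← Real.rpow_mul hτ0.le, ← mul_assoc,
      ← Real.rpow_add hτ0]
    push_cast
    ring_nf
  rw [e]
  refine h.congr_fun fun j => ?_
  rw [show α + 2 * s - 2 * j - 1 = α + 2 * s - 1 - (2 * j : ℕ) by push_cast; ring,
    Real.rpow_sub_natCast hτ0.ne', ← pow_mul, div_pow]
  ring

theorem hasSum_binomCoeff_mul_integral {p a s α : ℝ} (hp : 0 < p) (ha : 0 < a) (hs : -1 < s)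
    (hb : ∀ m : ℤ, α + 2 * s ≠ m) :
    HasSum (fun j : ℕ => binomCoeff s j * (a ^ (2 * j) *
      ∫ τ in Set.Ioi a, τ ^ (α + 2 * s - 2 * j - 1) * Real.exp (-p * τ)))
      (∫ τ in Set.Ioi a, τ ^ (α - 1) * Real.exp (-p * τ) * (τ ^ 2 - a ^ 2) ^ s) := by
  have key := hasSum_integral_of_summable_integral_norm
    (F := fun (j : ℕ) τ => binomCoeff s j * (a ^ (2 * j) *
      (τ ^ (α + 2 * s - 2 * j - 1) * Real.exp (-p * τ))))
    (μ := volume.restrict (Set.Ioi a))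
    (fun j => ((integrableOn_rpow_mul_exp_neg_mul_Ioi _ hp ha).const_mul _).const_mul _) ?_
  · simp only [integral_const_mul] at key
    rw [setIntegral_congr_fun (g := fun τ => ∑' j : ℕ, binomCoeff s j * (a ^ (2 * j) *
      (τ ^ (α + 2 * s - 2 * j - 1) * Real.exp (-p * τ)))) measurableSet_Ioi]
    · exact key
    intro τ hτ
    have h := (hasSum_rpow_mul_sq_sub_sq_rpow (α := α) (s := s) ha hτ).mul_right
      (Real.exp (-p * τ))
    simp only
    rw [mul_right_comm, ← h.tsum_eq]
    exact tsum_congr fun j => by ring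
  · refine (summable_binomCoeff_mul_integral hp ha hs hb).congr fun j => ?_
    rw [← integral_const_mul, ← integral_const_mul]
    refine setIntegral_congr_fun measurableSet_Ioi fun τ hτ => ?_
    have : 0 < τ := ha.trans hτ
    simp only [norm_mul, Real.norm_eq_abs]
    rw [abs_of_nonneg (a := a ^ (2 * j)) (by positivity),
      abs_of_nonneg (a := τ ^ (_ : ℝ)) (by positivity), Real.abs_exp]

/-- The small denominators cost at most a factor (n + 1)/(j + 1), so a product of two convergent
series dominates. This licenses the interchange of sums. -/
theorem summable_binomCoeff_mul_pow_div {p a s b : ℝ} (hp : 0 < p) (ha : 0 < a) (hs : -1 < s)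
    (hb : ∀ m : ℤ, b ≠ m) :
    Summable fun q : ℕ × ℕ => (-p) ^ q.2 / (q.2.factorial : ℝ) * a ^ (b + q.2) *
      (binomCoeff s q.1 / (b + q.2 - 2 * q.1)) := by
  obtain ⟨C, hC, h⟩ := exists_inv_abs_le hb
  have hprod := (summable_abs_binomCoeff_div hs).mul_of_nonneg
    ((summable_pow_mul_add_one_div_factorial (p * a)).mul_left (C * a ^ b))
    (fun j => by positivity) (fun n => by positivity)
  refine hprod.of_norm_bounded fun q => ?_
  rw [Real.norm_eq_abs, abs_mul, abs_mul, abs_div, abs_div, abs_pow, abs_neg,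
    abs_of_pos hp, Nat.abs_cast, abs_of_pos (Real.rpow_pos_of_pos ha _), Real.rpow_add ha,
    Real.rpow_natCast, div_eq_mul_inv |binomCoeff s q.1|]
  calc _ ≤ p ^ q.2 / (q.2.factorial : ℝ) * (a ^ b * a ^ q.2) *
        (|binomCoeff s q.1| * (C * (q.2 + 1) / (q.1 + 1))) := by
        gcongr
        exact h q.2 q.1
    _ = _ := by rw [mul_pow]; ring

/-- Fubini for the double series: summing over n first gives the left-hand terms, summing over j
first gives the beta values, as b + n - 2j = -2(j - (b + n)/2). -/
theorem hasSum_binomCoeff_mul_lowerGammaTerm {p a s b : ℝ} (hp : 0 < p) (ha : 0 < a) (hs : -1 < s)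
    (hb : ∀ m : ℤ, b ≠ m) :
    HasSum (fun j : ℕ => binomCoeff s j * (a ^ (2 * j) * ∑' n, lowerGammaTerm p a (b - 2 * j) n))
      (∑' n : ℕ, (-p) ^ n / (n.factorial : ℝ) * a ^ (b + n) *
        (-(1 / 2) * ProbabilityTheory.beta (s + 1) (-(b + n) / 2))) := by
  have hd := summable_binomCoeff_mul_pow_div (p := p) hp ha hs hb
  have hrow : ∀ j : ℕ, ∑' n : ℕ, (-p) ^ n / (n.factorial : ℝ) * a ^ (b + n) *
      (binomCoeff s j / (b + n - 2 * j)) =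
      binomCoeff s j * (a ^ (2 * j) * ∑' n, lowerGammaTerm p a (b - 2 * j) n) := by
    intro j
    rw [← tsum_mul_left, ← tsum_mul_left]
    refine tsum_congr fun n => ?_
    have hpow : a ^ (b + n) = a ^ (2 * j) * a ^ (b - 2 * j + n) := by
      rw [← Real.rpow_natCast a (2 * j), ← Real.rpow_add ha]
      push_cast
      ring_nf
    rw [lowerGammaTerm, hpow, show b - 2 * j + (n : ℝ) = b + n - 2 * j by ring]
    ring
  have hcol : ∀ n : ℕ, ∑' j : ℕ, (-p) ^ n / (n.factorial : ℝ) * a ^ (b + n) *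
      (binomCoeff s j / (b + n - 2 * j)) = (-p) ^ n / (n.factorial : ℝ) * a ^ (b + n) *
        (-(1 / 2) * ProbabilityTheory.beta (s + 1) (-(b + n) / 2)) := by
    intro n
    rw [tsum_mul_left]
    congr 1
    have hv : ∀ m : ℤ, -(b + n) / 2 ≠ m := fun m h => hb (-(2 * m) - n) (by push_cast; linarith)
    rw [← (hasSum_binomCoeff_div hs hv).tsum_eq, ← tsum_mul_left]
    refine tsum_congr fun j => ?_
    have h1 : b + n - 2 * j ≠ 0 := fun h => hb (2 * j - n) (by push_cast; linarith)
    rw [show (j : ℝ) + -(b + n) / 2 = -(1 / 2) * (b + n - 2 * j) by ring]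
    field_simp
  have h1 := hd.hasSum.prod_fiberwise fun j => (hd.prod_factor j).hasSum
  simp only [hrow] at h1
  rw [hd.tsum_prod, ← Summable.tsum_comm (f := fun j n : ℕ => (-p) ^ n / (n.factorial : ℝ) *
    a ^ (b + n) * (binomCoeff s j / (b + n - 2 * j))) hd] at h1
  simpa only [hcol] using h1

theorem hasSum_binomCoeff_mul_Gamma {p a s b : ℝ} (hp : 0 < p)
    (hb : ∀ m : ℤ, b ≠ m) :
    HasSum (fun j : ℕ => binomCoeff s j * (a ^ (2 * j) *
        (p ^ (-(b - 2 * j)) * Real.Gamma (b - 2 * j))))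
      (p ^ (-b) * Real.Gamma b * hyp1F2 (-s) (-(b - 2) / 2) (-(b - 1) / 2) (p ^ 2 * a ^ 2 / 4)) := by
  refine ((summable_hyp1F2Term _ _ _ _).hasSum.mul_left _).congr_fun fun j => ?_
  rw [Gamma_sub_two_mul hb, hyp1F2Term, binomCoeff,
    show -(b - 2 * j) = -b + (2 * j : ℕ) by push_cast; ring, Real.rpow_add hp, Real.rpow_natCast,
    pow_mul, pow_mul, div_pow, mul_pow]
  simp only [div_eq_mul_inv, mul_inv]
  ring

/-- Even n = 2m and odd n = 2m + 1 shift the beta argument by the integer m, and (2m)!, (2m + 1)!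
contribute the parameters 1/2 and 3/2. -/
theorem tsum_beta_even_odd {p a s α : ℝ} (ha : 0 < a)
    (hα : ∀ m : ℤ, α ≠ m) (hb : ∀ m : ℤ, α + 2 * s ≠ m) :
    ∑' n : ℕ, (-p) ^ n / (n.factorial : ℝ) * a ^ (α + 2 * s + n) *
        (-(1 / 2) * ProbabilityTheory.beta (s + 1) (-(α + 2 * s + n) / 2)) =
      -(1 / 2) * (a ^ (α + 2 * s) * ProbabilityTheory.beta (s + 1) (-(α + 2 * s) / 2) *
          hyp1F2 (α / 2) (1 / 2) ((α + 2 * s) / 2 + 1) (p ^ 2 * a ^ 2 / 4) -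
        p * a ^ (α + 2 * s + 1) * ProbabilityTheory.beta (s + 1) (-(α + 2 * s + 1) / 2) *
          hyp1F2 ((1 + α) / 2) (3 / 2) ((α + 2 * s + 1) / 2 + 1) (p ^ 2 * a ^ 2 / 4)) := by
  set b := α + 2 * s with hbdef
  have heven := (summable_hyp1F2Term (α / 2) (1 / 2) (b / 2 + 1) (p ^ 2 * a ^ 2 / 4)).hasSum.mul_left
    (-(1 / 2) * (a ^ b * ProbabilityTheory.beta (s + 1) (-b / 2)))
  have hodd := (summable_hyp1F2Term ((1 + α) / 2) (3 / 2) ((b + 1) / 2 + 1)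
    (p ^ 2 * a ^ 2 / 4)).hasSum.mul_left
    (1 / 2 * (p * a ^ (b + 1) * ProbabilityTheory.beta (s + 1) (-(b + 1) / 2)))
  have hv0 : ∀ m : ℤ, -b / 2 ≠ m := fun m h => hb (-(2 * m)) (by push_cast; linarith)
  have hv1 : ∀ m : ℤ, -(b + 1) / 2 ≠ m := fun m h => hb (-(2 * m) - 1) (by push_cast; linarith)
  have hu0 : ∀ m : ℤ, s + 1 + -b / 2 ≠ m := fun m h => hα (-(2 * m) + 2) (by push_cast; linarith)
  have hu1 : ∀ m : ℤ, s + 1 + -(b + 1) / 2 ≠ m :=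
    fun m h => hα (-(2 * m) + 1) (by push_cast; linarith)
  have h := HasSum.even_add_odd (f := fun n : ℕ => (-p) ^ n / (n.factorial : ℝ) * a ^ (b + n) *
        (-(1 / 2) * ProbabilityTheory.beta (s + 1) (-(b + n) / 2)))
    (heven.congr_fun fun m => ?_) (hodd.congr_fun fun m => ?_)
  · rw [h.tsum_eq, hyp1F2, hyp1F2]
    ring
  · rw [show -(b + (2 * m : ℕ)) / 2 = -b / 2 - m by push_cast; ring, beta_sub_natCast hv0 hu0,
      factorial_two_mul, Real.rpow_add ha, Real.rpow_natCast, hyp1F2Term,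
      show 1 - (s + 1) - -b / 2 = α / 2 by rw [hbdef]; ring,
      show 1 - -b / 2 = b / 2 + 1 by ring, pow_mul, pow_mul, neg_sq, div_pow, mul_pow]
    simp only [div_eq_mul_inv, mul_inv]
    ring
  · rw [show -(b + (2 * m + 1 : ℕ)) / 2 = -(b + 1) / 2 - m by push_cast; ring,
      beta_sub_natCast hv1 hu1,
      factorial_two_mul_add_one, show b + ((2 * m + 1 : ℕ) : ℝ) = b + 1 + (2 * m : ℕ) by
        push_cast; ring, Real.rpow_add ha (b + 1), Real.rpow_natCast, hyp1F2Term,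
      show 1 - (s + 1) - -(b + 1) / 2 = (1 + α) / 2 by rw [hbdef]; ring,
      show 1 - -(b + 1) / 2 = (b + 1) / 2 + 1 by ring, pow_succ, pow_mul, pow_mul, neg_sq, div_pow,
      mul_pow]
    simp only [div_eq_mul_inv, mul_inv]
    ring

theorem two_mul_integral_eq_hyp1F2 {p a s α : ℝ} (hp : 0 < p) (ha : 0 < a) (hs : -1 < s)
    (hα : ∀ m : ℤ, α ≠ m) (hb : ∀ m : ℤ, α + 2 * s ≠ m) :
    2 * ∫ τ in Set.Ioi a, τ ^ (α - 1) * Real.exp (-p * τ) * (τ ^ 2 - a ^ 2) ^ s =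
      a ^ (α + 2 * s) * ProbabilityTheory.beta (s + 1) (-(α + 2 * s) / 2) *
          hyp1F2 (α / 2) (1 / 2) ((α + 2 * s) / 2 + 1) (p ^ 2 * a ^ 2 / 4) -
        p * a ^ (α + 2 * s + 1) * ProbabilityTheory.beta (s + 1) (-(α + 2 * s + 1) / 2) *
          hyp1F2 ((1 + α) / 2) (3 / 2) ((α + 2 * s + 1) / 2 + 1) (p ^ 2 * a ^ 2 / 4) +
        2 * (p ^ (-(α + 2 * s)) * Real.Gamma (α + 2 * s) *
          hyp1F2 (-s) (-(α + 2 * s - 2) / 2) (-(α + 2 * s - 1) / 2) (p ^ 2 * a ^ 2 / 4)) := by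
  have h1 := hasSum_binomCoeff_mul_integral hp ha hs hb
  have h2 := (hasSum_binomCoeff_mul_Gamma (a := a) (s := s) hp hb).sub
    (hasSum_binomCoeff_mul_lowerGammaTerm hp ha hs hb)
  have h3 := h1.unique (h2.congr_fun fun j => by
    rw [integral_Ioi_rpow_mul_exp_neg_mul hp ha
      (fun m h => hb (m + 2 * j) (by push_cast; linarith)), mul_sub, mul_sub])
  rw [h3, tsum_beta_even_odd ha hα hb]
  ring

/-! ### Integrability, and the moments as functions of the shape -/

theorem exists_rpow_le_mul_exp {d ε : ℝ} (hd : 0 < d) (hε : 0 < ε) :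
    ∃ M > 0, ∀ t > 0, t ^ d ≤ M * Real.exp (ε * t) := by
  -- Raise u ≤ e^u, with u = εt/d, to the power d.
  refine ⟨(d / ε) ^ d, by positivity, fun t ht => ?_⟩
  have h1 : ε / d * t ≤ Real.exp (ε / d * t) := by linarith [Real.add_one_le_exp (ε / d * t)]
  calc t ^ d = (d / ε * (ε / d * t)) ^ d := by congr 1; field_simp
    _ = (d / ε) ^ d * (ε / d * t) ^ d := Real.mul_rpow (by positivity) (by positivity)
    _ ≤ (d / ε) ^ d * (Real.exp (ε / d * t)) ^ d := by gcongr
    _ = _ := by rw [← Real.exp_mul]; congr 2; field_simp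

theorem sqrt_sq_sub_sq_pos {a τ : ℝ} (ha : 0 ≤ a) (hτ : a < τ) : 0 < √(τ ^ 2 - a ^ 2) :=
  Real.sqrt_pos.mpr (by nlinarith)

theorem sqrt_sq_sub_sq_le {a τ : ℝ} (ha : 0 ≤ a) (hτ : a < τ) : √(τ ^ 2 - a ^ 2) ≤ τ :=
  Real.sqrt_le_iff.mpr ⟨by linarith, by nlinarith⟩

/-- Since √(τ² - a²) ≥ √(τ - a)√τ, what remains is τ^(α-3/2), absorbed by half of the exponential.
This is where 3/2 < α enters, and the bound covers a = 0 as well. -/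
theorem integrableOn_rpow_mul_exp_div_sqrt {a μ α : ℝ} (ha : 0 ≤ a) (hμ : 0 < μ)
    (hα : 3 / 2 < α) :
    IntegrableOn (fun τ : ℝ => τ ^ (α - 1) * Real.exp (-μ * τ) / √(τ ^ 2 - a ^ 2))
      (Set.Ioi a) := by
  obtain ⟨M, hM, hle⟩ := exists_rpow_le_mul_exp (d := α - 3 / 2) (ε := μ / 2)
    (by linarith) (by linarith)
  have h0 : IntegrableOn (fun t : ℝ => t ^ (-(1 / 2) : ℝ) * Real.exp (-(μ / 2) * t))
      (Set.Ioi 0) := by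
    simpa using integrableOn_rpow_mul_exp_neg_mul_rpow (s := -(1 / 2)) (p := 1) (b := μ / 2)
      (by norm_num) one_pos (by linarith)
  have h1 : IntegrableOn (fun τ : ℝ => (τ - a) ^ (-(1 / 2) : ℝ) * Real.exp (-(μ / 2) * (τ - a)))
      (Set.Ioi a) := by
    have := ((measurePreserving_sub_right volume a).integrableOn_comp_preimage
      (measurableEmbedding_subRight a)).mpr h0
    simpa [Function.comp_def] using this
  refine (h1.const_mul M).mono' (Measurable.aestronglyMeasurable (by fun_prop)) ?_
  filter_upwards [ae_restrict_mem measurableSet_Ioi] with τ hτ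
  have hτ0 : 0 < τ := ha.trans_lt hτ
  have hd : 0 < τ - a := sub_pos.mpr hτ
  have hq := sqrt_sq_sub_sq_pos ha hτ
  rw [Real.norm_of_nonneg (by positivity)]
  have hsq : √(τ ^ 2 - a ^ 2) = √(τ - a) * √(τ + a) := by
    rw [← Real.sqrt_mul hd.le]
    congr 1
    ring
  have hge : √(τ - a) * √τ ≤ √(τ ^ 2 - a ^ 2) := by
    rw [hsq]
    gcongr
    linarith
  have hs1 : 0 < √(τ - a) := Real.sqrt_pos.mpr hd
  have hs2 : 0 < √τ := Real.sqrt_pos.mpr hτ0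
  have e1 : τ ^ (α - 1) = τ ^ (α - 3 / 2) * √τ := by
    rw [Real.sqrt_eq_rpow, ← Real.rpow_add hτ0]
    ring_nf
  have e2 : Real.exp (-μ * τ) = Real.exp (-(μ / 2) * τ) * Real.exp (-(μ / 2) * τ) := by
    rw [← Real.exp_add]
    ring_nf
  have e3 : Real.exp (μ / 2 * τ) * Real.exp (-(μ / 2) * τ) = 1 := by
    rw [← Real.exp_add]
    ring_nf
    exact Real.exp_zero
  calc τ ^ (α - 1) * Real.exp (-μ * τ) / √(τ ^ 2 - a ^ 2)
      ≤ τ ^ (α - 1) * Real.exp (-μ * τ) / (√(τ - a) * √τ) := by gcongr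
    _ = τ ^ (α - 3 / 2) * Real.exp (-(μ / 2) * τ) * Real.exp (-(μ / 2) * τ) / √(τ - a) := by
        rw [e1, e2]
        field_simp
    _ ≤ M * Real.exp (μ / 2 * τ) * Real.exp (-(μ / 2) * τ) * Real.exp (-(μ / 2) * (τ - a)) /
          √(τ - a) := by
        gcongr ?_ * _ * ?_ / _
        · exact hle τ hτ0
        · exact Real.exp_le_exp.mpr (by nlinarith)
    _ = _ := by
        rw [mul_assoc M, e3, mul_one, Real.rpow_neg hd.le, ← Real.sqrt_eq_rpow]
        ring

theorem integrableOn_rpow_mul_exp_mul_exp_sqrt {a lam μ α : ℝ} (ha : 0 ≤ a) (hlam : 0 < lam)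
    (hμ : 0 < μ) (hα : 3 / 2 < α) :
    IntegrableOn (fun τ : ℝ => τ ^ (α - 1) * Real.exp (-(lam + μ) * τ) *
      (Real.exp (lam * √(τ ^ 2 - a ^ 2)) / √(τ ^ 2 - a ^ 2))) (Set.Ioi a) := by
  refine (integrableOn_rpow_mul_exp_div_sqrt ha hμ hα).mono' (by fun_prop) ?_
  filter_upwards [ae_restrict_mem measurableSet_Ioi] with τ hτ
  have hτ0 : 0 < τ := ha.trans_lt hτ
  have hq := sqrt_sq_sub_sq_pos ha hτ
  have hle := sqrt_sq_sub_sq_le ha hτ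
  rw [Real.norm_of_nonneg (by positivity), mul_div_assoc', mul_assoc, ← Real.exp_add]
  gcongr
  nlinarith

/-- The coefficient integral of `lam ^ k / k!` in the expansion of the stationary density. -/
noncomputable def lightMoment (a p : ℝ) (k : ℕ) (α : ℝ) : ℝ :=
  ∫ τ in Set.Ioi a, τ ^ (α - 1) * Real.exp (-p * τ) *
    (√(τ ^ 2 - a ^ 2) ^ k / √(τ ^ 2 - a ^ 2))

/-- The k-th power is at most a constant times an exponential of rate p/2, which leaves half of the
decay e^(-pτ). -/
theorem integrableOn_lightMoment {a p α : ℝ} (ha : 0 ≤ a) (hp : 0 < p) (hα : 3 / 2 < α) (k : ℕ) :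
    IntegrableOn (fun τ : ℝ => τ ^ (α - 1) * Real.exp (-p * τ) *
      (√(τ ^ 2 - a ^ 2) ^ k / √(τ ^ 2 - a ^ 2))) (Set.Ioi a) := by
  have h := (integrableOn_rpow_mul_exp_mul_exp_sqrt (lam := p / 2) (μ := p / 2) ha (by linarith)
    (by linarith) hα).const_mul (k.factorial / (p / 2) ^ k)
  refine h.mono' (by fun_prop) ?_
  filter_upwards [ae_restrict_mem measurableSet_Ioi] with τ hτ
  have hτ0 : 0 < τ := ha.trans_lt hτ
  have hq := sqrt_sq_sub_sq_pos ha hτ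
  rw [Real.norm_of_nonneg (by positivity), add_halves]
  have hexp := Real.pow_div_factorial_le_exp (p / 2 * √(τ ^ 2 - a ^ 2)) (by positivity) k
  have : √(τ ^ 2 - a ^ 2) ^ k ≤
      k.factorial / (p / 2) ^ k * Real.exp (p / 2 * √(τ ^ 2 - a ^ 2)) := by
    calc √(τ ^ 2 - a ^ 2) ^ k = k.factorial / (p / 2) ^ k *
          ((p / 2 * √(τ ^ 2 - a ^ 2)) ^ k / k.factorial) := by
          rw [mul_pow]
          field_simp
      _ ≤ _ := by gcongr
  calc _ ≤ τ ^ (α - 1) * Real.exp (-p * τ) * (k.factorial / (p / 2) ^ k *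
        Real.exp (p / 2 * √(τ ^ 2 - a ^ 2)) / √(τ ^ 2 - a ^ 2)) := by gcongr
    _ = _ := by ring

theorem hasSum_lightMoment {a lam μ α : ℝ} (ha : 0 ≤ a) (hlam : 0 < lam) (hμ : 0 < μ)
    (hα : 3 / 2 < α) :
    HasSum (fun k : ℕ => lam ^ k / (k.factorial : ℝ) * lightMoment a (lam + μ) k α)
      (∫ τ in Set.Ioi a, τ ^ (α - 1) * Real.exp (-(lam + μ) * τ) *
        (Real.exp (lam * √(τ ^ 2 - a ^ 2)) / √(τ ^ 2 - a ^ 2))) := by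
  simp only [lightMoment, ← integral_const_mul]
  have hsum : ∀ τ : ℝ, HasSum (fun k : ℕ => lam ^ k / (k.factorial : ℝ) *
      (τ ^ (α - 1) * Real.exp (-(lam + μ) * τ) * (√(τ ^ 2 - a ^ 2) ^ k / √(τ ^ 2 - a ^ 2))))
      (τ ^ (α - 1) * Real.exp (-(lam + μ) * τ) *
        (Real.exp (lam * √(τ ^ 2 - a ^ 2)) / √(τ ^ 2 - a ^ 2))) := by
    intro τ
    have h := (NormedSpace.expSeries_div_hasSum_exp (𝔸 := ℝ) (lam * √(τ ^ 2 - a ^ 2)))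
    rw [← Real.exp_eq_exp_ℝ] at h
    refine ((h.div_const √(τ ^ 2 - a ^ 2)).mul_left
      (τ ^ (α - 1) * Real.exp (-(lam + μ) * τ))).congr_fun fun k => ?_
    rw [mul_pow]
    ring
  -- The terms are nonnegative, so they serve as their own bounds; their sum is integrable.
  refine hasSum_integral_of_dominated_convergence _
    (fun k => (((integrableOn_lightMoment ha (by linarith) hα k).const_mul _).aestronglyMeasurable))
    (fun k => ?_) (ae_of_all _ fun τ => (hsum τ).summable) ?_ (ae_of_all _ hsum)
  · filter_upwards [ae_restrict_mem measurableSet_Ioi] with τ hτ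
    have hτ0 : 0 < τ := ha.trans_lt hτ
    exact (Real.norm_of_nonneg (by positivity)).le
  · exact (integrableOn_rpow_mul_exp_mul_exp_sqrt ha hlam hμ hα).congr
      (ae_of_all _ fun τ => (hsum τ).tsum_eq.symm)

/-- For β between α₁ and α + 1, τ^(β-1) is at most τ^(α₁-1) when τ ≤ 1 and at most τ^α when τ ≥ 1;
the sum of the two dominates. -/
theorem continuousAt_lightMoment {a p α : ℝ} (ha : 0 ≤ a) (hp : 0 < p) (hα : 3 / 2 < α) (k : ℕ) :
    ContinuousAt (lightMoment a p k) α := by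
  obtain ⟨α₁, h₁, h₁'⟩ := exists_between hα
  have i1 := integrableOn_lightMoment ha hp h₁ k
  have i2 := integrableOn_lightMoment ha hp (show 3 / 2 < α + 1 by linarith) k
  refine tendsto_integral_filter_of_dominated_convergence _ (.of_forall fun β => by fun_prop) ?_
    (i1.add i2) ?_
  · filter_upwards [Ioo_mem_nhds h₁' (lt_add_one α)] with β hβ
    filter_upwards [ae_restrict_mem measurableSet_Ioi] with τ hτ
    have hτ0 : 0 < τ := ha.trans_lt hτ
    rw [Real.norm_of_nonneg (by positivity)]
    rw [Pi.add_apply, ← add_mul, ← add_mul]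
    gcongr
    rcases le_total τ 1 with h | h
    · have := Real.rpow_le_rpow_of_exponent_ge hτ0 h (show α₁ - 1 ≤ β - 1 by linarith [hβ.1])
      have := Real.rpow_nonneg hτ0.le (α + 1 - 1)
      linarith
    · have := Real.rpow_le_rpow_of_exponent_le h (show β - 1 ≤ α + 1 - 1 by linarith [hβ.2])
      have := Real.rpow_nonneg hτ0.le (α₁ - 1)
      linarith
  · filter_upwards [ae_restrict_mem measurableSet_Ioi] with τ hτ
    have hτ0 : 0 < τ := ha.trans_lt hτ
    refine Tendsto.mul_const _ (Tendsto.mul_const _ ?_)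
    exact ((Real.continuousAt_const_rpow hτ0.ne').tendsto).comp (tendsto_id.sub_const 1)

/-! ### The bracket as twice a moment -/

theorem hyp1F2_zero (ξ η ζ : ℝ) : hyp1F2 ξ η ζ 0 = 1 := by
  rw [hyp1F2, tsum_eq_single 0]
  · simp [hyp1F2Term]
  · intro n hn
    simp [hyp1F2Term, hn]

theorem lightBracket_eq {lam c μ β : ℝ} (hlam : 0 < lam) (hc : 0 < c) (hμ : 0 < μ)
    (hβ : 1 < β) (hβ' : ∀ m : ℤ, β ≠ m) (x : EuclideanSpace ℝ (Fin 2)) (k : ℕ) :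
    lightBracket lam c μ x k β = 2 * lightMoment (‖x‖ / c) (lam + μ) k β := by
  have hk : (0 : ℝ) ≤ k := by positivity
  have hp : 0 < lam + μ := by linarith
  have hz : (lam + μ) ^ 2 * ‖x‖ ^ 2 / (4 * c ^ 2) = (lam + μ) ^ 2 * (‖x‖ / c) ^ 2 / 4 := by
    field_simp
  rw [lightBracket, hz]
  have ha0 : 0 ≤ ‖x‖ / c := by positivity
  set a := ‖x‖ / c
  rcases ha0.eq_or_lt with ha | ha
  -- At the origin β > 1 makes both powers of 0 vanish; only the third term survives, and it is a
  -- complete gamma integral.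
  · rw [← ha, Real.zero_rpow (by linarith), Real.zero_rpow (by linarith)]
    have hG := Real.integral_rpow_mul_exp_neg_mul_Ioi (a := β + k - 1) (by linarith) hp
    have : lightMoment 0 (lam + μ) k β =
        ∫ t in Set.Ioi (0 : ℝ), t ^ (β + k - 1 - 1) * Real.exp (-((lam + μ) * t)) := by
      refine setIntegral_congr_fun measurableSet_Ioi fun t ht => ?_
      have ht0 : 0 < t := ht
      rw [zero_pow two_ne_zero, sub_zero, Real.sqrt_sq ht0.le, ← Real.rpow_natCast,
        show β + k - 1 - 1 = β - 1 + (k - 1) by ring, Real.rpow_add ht0, Real.rpow_sub_one ht0.ne' k,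
        neg_mul]
      ring
    have hz0 : (lam + μ) ^ 2 * (0 : ℝ) ^ 2 / 4 = 0 := by simp
    have hpow : (1 / (lam + μ)) ^ (β + k - 1) = (lam + μ) ^ (1 - β - k) := by
      rw [one_div, Real.inv_rpow hp.le, ← Real.rpow_neg hp.le]
      ring_nf
    rw [this, hG, hpow, hz0, hyp1F2_zero, hyp1F2_zero, hyp1F2_zero]
    ring
  · have e : lightMoment a (lam + μ) k β = ∫ τ in Set.Ioi a, τ ^ (β - 1) *
        Real.exp (-(lam + μ) * τ) * (τ ^ 2 - a ^ 2) ^ (((k : ℝ) - 1) / 2) := by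
      refine setIntegral_congr_fun measurableSet_Ioi fun τ hτ => ?_
      have hq := Real.sqrt_pos.mp (sqrt_sq_sub_sq_pos ha.le hτ)
      congr 1
      rw [← Real.rpow_natCast, ← Real.rpow_sub_one (Real.sqrt_pos.mpr hq).ne', Real.sqrt_eq_rpow,
        ← Real.rpow_mul hq.le]
      ring_nf
    rw [e, two_mul_integral_eq_hyp1F2 hp ha (by linarith) hβ'
      (fun m h => hβ' (m - k + 1) (by push_cast; linarith))]
    ring_nf

/-! ### The stationary density -/

theorem sqrt_sq_mul_sub_norm_sq {c : ℝ} (hc : 0 < c) (x : EuclideanSpace ℝ (Fin 2)) (τ : ℝ) :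
    √(c ^ 2 * τ ^ 2 - ‖x‖ ^ 2) = c * √(τ ^ 2 - (‖x‖ / c) ^ 2) := by
  rw [show c ^ 2 * τ ^ 2 - ‖x‖ ^ 2 = c ^ 2 * (τ ^ 2 - (‖x‖ / c) ^ 2) by field_simp,
    Real.sqrt_mul (by positivity), Real.sqrt_sq hc.le]

theorem lightDensity_eq_integral {lam c μ α : ℝ} (hc : 0 < c) (x : EuclideanSpace ℝ (Fin 2)) :
    lightDensity lam c μ α x =
      lam * μ ^ α / (2 * Real.pi * c * Real.Gamma α) *
        ∫ τ in Set.Ioi (‖x‖ / c), τ ^ (α - 1) * Real.exp (-(lam + μ) * τ) *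
          (Real.exp (lam / c * Real.sqrt (c ^ 2 * τ ^ 2 - ‖x‖ ^ 2)) /
            Real.sqrt (c ^ 2 * τ ^ 2 - ‖x‖ ^ 2)) := by
  have ha : 0 ≤ ‖x‖ / c := by positivity
  rw [lightDensity, stationaryDensity, ← integral_const_mul,
    setIntegral_eq_of_subset_of_forall_sdiff_eq_zero measurableSet_Ioi (Set.Ioi_subset_Ioi ha)]
  · refine setIntegral_congr_fun measurableSet_Ioi fun τ hτ => ?_
    have h1 : ‖x‖ < c * τ := by
      rw [mul_comm]
      exact (div_lt_iff₀ hc).mp hτ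
    rw [flightACDensity, gammaLifetimeDensity, if_pos h1, if_pos (ha.trans_lt hτ), Real.exp_add,
      show -(lam + μ) * τ = -lam * τ + -μ * τ by ring, Real.exp_add]
    ring
  · rintro τ ⟨-, hτ⟩
    have : ¬ ‖x‖ < c * τ := by
      rw [mul_comm, ← div_lt_iff₀ hc]
      exact hτ
    rw [flightACDensity, if_neg this, zero_mul]

theorem hasSum_lightDensity {lam c μ α : ℝ} (hlam : 0 < lam) (hc : 0 < c) (hμ : 0 < μ)
    (hα : 3 / 2 < α) (x : EuclideanSpace ℝ (Fin 2)) :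
    HasSum (fun k : ℕ => lam * μ ^ α / (4 * Real.pi * c ^ 2 * Real.Gamma α) *
        (lam ^ k / (k.factorial : ℝ) * (2 * lightMoment (‖x‖ / c) (lam + μ) k α)))
      (lightDensity lam c μ α x) := by
  have h := (hasSum_lightMoment (a := ‖x‖ / c) (by positivity) hlam hμ hα).mul_left
    (lam * μ ^ α / (2 * Real.pi * c * Real.Gamma α) * (1 / c))
  have e : lightDensity lam c μ α x = lam * μ ^ α / (2 * Real.pi * c * Real.Gamma α) * (1 / c) *
      ∫ τ in Set.Ioi (‖x‖ / c), τ ^ (α - 1) * Real.exp (-(lam + μ) * τ) *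
        (Real.exp (lam * √(τ ^ 2 - (‖x‖ / c) ^ 2)) / √(τ ^ 2 - (‖x‖ / c) ^ 2)) := by
    rw [lightDensity_eq_integral hc, mul_assoc (lam * μ ^ α / _), ← integral_const_mul (1 / c)]
    congr 1
    refine setIntegral_congr_fun measurableSet_Ioi fun τ _ => ?_
    rw [sqrt_sq_mul_sub_norm_sq hc, ← mul_assoc (lam / c), div_mul_cancel₀ _ hc.ne']
    field_simp
  rw [e]
  refine h.congr_fun fun k => ?_
  field_simp
  norm_num

theorem theorem2 (lam c μ α : ℝ) (hlam : 0 < lam) (hc : 0 < c) (hμ : 0 < μ) (hα : 2 < α)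
    (x : EuclideanSpace ℝ (Fin 2)) :
    -- the integral giving the density converges
    IntegrableOn (fun τ : ℝ => τ ^ (α - 1) * Real.exp (-(lam + μ) * τ) *
        (Real.exp (lam / c * Real.sqrt (c ^ 2 * τ ^ 2 - ‖x‖ ^ 2)) /
          Real.sqrt (c ^ 2 * τ ^ 2 - ‖x‖ ^ 2))) (Set.Ioi (‖x‖ / c)) ∧
    -- the density as an integral
    lightDensity lam c μ α x =
      lam * μ ^ α / (2 * Real.pi * c * Real.Gamma α) *
        ∫ τ in Set.Ioi (‖x‖ / c), τ ^ (α - 1) * Real.exp (-(lam + μ) * τ) *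
          (Real.exp (lam / c * Real.sqrt (c ^ 2 * τ ^ 2 - ‖x‖ ^ 2)) /
            Real.sqrt (c ^ 2 * τ ^ 2 - ‖x‖ ^ 2)) ∧
    -- the density as a series, when no coefficient of the series has a pole
    ((∀ m : ℤ, α ≠ m) →
      HasSum (fun k : ℕ => lam * μ ^ α / (4 * Real.pi * c ^ 2 * Real.Gamma α) *
          (lam ^ k / (k.factorial : ℝ) * lightBracket lam c μ x k α))
        (lightDensity lam c μ α x)) ∧
    -- the same for every shape, each term being continued to the integers by its limit
    (∃ T : ℕ → ℝ,
      (∀ k : ℕ, Tendsto (lightBracket lam c μ x k) (𝓝[{β : ℝ | ∀ m : ℤ, β ≠ m}] α) (𝓝 (T k))) ∧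
      HasSum (fun k : ℕ => lam * μ ^ α / (4 * Real.pi * c ^ 2 * Real.Gamma α) *
          (lam ^ k / (k.factorial : ℝ) * T k))
        (lightDensity lam c μ α x)) := by

  have hα' : 3 / 2 < α := by linarith
  refine ⟨?_, lightDensity_eq_integral hc x, fun hint => ?_,
    fun k => 2 * lightMoment (‖x‖ / c) (lam + μ) k α, fun k => ?_,
    hasSum_lightDensity hlam hc hμ hα' x⟩
  · have h := (integrableOn_rpow_mul_exp_mul_exp_sqrt (a := ‖x‖ / c) (by positivity) hlam hμ
      hα').const_mul (1 / c)
    refine h.congr (ae_of_all _ fun τ => ?_)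
    simp only
    rw [sqrt_sq_mul_sub_norm_sq hc, ← mul_assoc (lam / c), div_mul_cancel₀ _ hc.ne']
    field_simp
  · have h := hasSum_lightDensity hlam hc hμ hα' x
    simpa only [lightBracket_eq hlam hc hμ (by linarith) hint] using h
  -- Off the integers near α the bracket is twice the moment, which has no singularity at α.
  · have hcont := (continuousAt_lightMoment (a := ‖x‖ / c) (p := lam + μ) (by positivity)
      (by linarith) hα' k).tendsto.const_mul 2
    refine (hcont.mono_left nhdsWithin_le_nhds).congr' ?_
    filter_upwards [self_mem_nhdsWithin,
      nhdsWithin_le_nhds (lt_mem_nhds (show 1 < α by linarith))] with β hβ hβ1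
    exact (lightBracket_eq hlam hc hμ hβ1 hβ x k).symm
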